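/- Let $\mathbb{T}$ be the unit circle and $\mathbb{D}$ the open unit disc of $\mathbb{C}$. For a Borel probability measure $\mu$ on $\mathbb{T}$ put $$\psi_\mu(z)=\int_{\mathbb{T}}\frac{tz}{1-tz}\,d\mu(t),\qquad \eta_\mu(z)=\frac{\psi_\mu(z)}{1+\psi_\mu(z)},\qquad z\in\mathbb{D}.$$ If $\mu$ has nonzero mean $\int_{\mathbb{T}}t\,d\mu(t)=\eta_\mu'(0)$, then $\eta_\mu$ has an analytic inverse $\eta_\mu^{-1}$ near $0$ with $\eta_\mu^{-1}(0)=0$, and one sets $\Sigma_\mu(z)=\eta_\mu^{-1}(z)/z$, an analytic function near $0$ with $\Sigma_\mu(0)\neq 0$. **Theorem.** Let $\mu$ be a Borel probability measure on $\mathbb{T}$ with nonzero mean. Assume that for every real $t>1$ there is a Borel probability measure $\mu_t$ on $\mathbb{T}$ with nonzero mean such that 1. $\Sigma_{\mu_t}(z)=(\Sigma_\mu(z))^t$ for all $z$ in a neighbourhood of $0$, for some analytic branch of the power, i.e. there is a function $L$, analytic near $0$, with $\Sigma_\mu=e^{L}$ and $\Sigma_{\mu_t}=e^{tL}$ near $0$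 (the branch $L$ may depend on $t$); 2. $\mu_t$ is subordinated with respect to $\mu$, i.e. there is an analytic function $\omega_t:\mathbb{D}\to\mathbb{D}$ with $\omega_t(0)=0$ and $\eta_{\mu_t}(z)=\eta_\mu(\omega_t(z))$ for all $z\in\mathbb{D}$. Then $\eta_\mu(z)\neq 0$ for all $z\in\mathbb{D}\setminus\{0\}$; that is, $\mu$ belongs to the class $\mathcal{M}_{\mathbb{T}}^*$ of probability measures on $\mathbb{T}$ with nonzero mean whose $\eta$-transform has no zero in $\mathbb{D}\setminus\{0\}$. -/

import Mathlib

open MeasureTheory Filter Topology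

noncomputable section

namespace CircleTransform

/-- The unit circle carries its Borel `σ`-algebra. -/
instance instMeasurableSpaceCircle : MeasurableSpace Circle := borel Circle

instance instBorelSpaceCircle : BorelSpace Circle := ⟨rfl⟩

/-- The mean (first moment) of a probability measure on the unit circle. -/
def mean (μ : ProbabilityMeasure Circle) : ℂ :=
  ∫ t : Circle, (t : ℂ) ∂(μ : Measure Circle)

/-- The moment generating function `ψ_μ(z) = ∫ tz / (1 - tz) dμ(t)`, used for `|z| < 1`. -/
def psi (μ : ProbabilityMeasure Circle) (z : ℂ) : ℂ :=
  ∫ t : Circle, (t : ℂ) * z / (1 - (t : ℂ) * z) ∂(μ : Measure Circle)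

/-- The transform `η_μ = ψ_μ / (1 + ψ_μ)`, used for `|z| < 1`, where `1 + ψ_μ(z) ≠ 0`. -/
def eta (μ : ProbabilityMeasure Circle) (z : ℂ) : ℂ :=
  psi μ z / (1 + psi μ z)

/-- `χ` is an analytic inverse of `f` near the origin, fixing the origin. -/
def IsLocalInverse (f χ : ℂ → ℂ) : Prop :=
  AnalyticAt ℂ χ 0 ∧ χ 0 = 0 ∧ (∀ᶠ z in 𝓝 0, f (χ z) = z) ∧ ∀ᶠ z in 𝓝 0, χ (f z) = z

open Classical in
/-- The inverse `η_μ⁻¹` near the origin. For `μ` of nonzero mean it exists, see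
`exists_isLocalInverse_eta`, and its germ at the origin is unique, see `IsLocalInverse.unique`.
Only that germ is meaningful. -/
def etaInv (μ : ProbabilityMeasure Circle) : ℂ → ℂ :=
  if h : ∃ χ, IsLocalInverse (eta μ) χ then h.choose else 0

/-- The transform `Σ_μ(z) = η_μ⁻¹(z) / z`, as a germ at the origin, for `μ` of nonzero mean.
At `z = 0` the removable singularity is filled in: the value is `(η_μ⁻¹)'(0)`. -/
def sigmaTransform (μ : ProbabilityMeasure Circle) : ℂ → ℂ :=
  dslope (etaInv μ) 0

/-- `G = F ^ t` near the origin, for some analytic branch `exp (t log F)` of the power. -/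
def IsPower (G F : ℂ → ℂ) (t : ℝ) : Prop :=
  ∃ L : ℂ → ℂ, AnalyticAt ℂ L 0 ∧ (∀ᶠ z in 𝓝 0, F z = Complex.exp (L z)) ∧
    ∀ᶠ z in 𝓝 0, G z = Complex.exp ((t : ℂ) * L z)

/-- `ν` is subordinated to `μ`: there is an analytic `ω : 𝔻 → 𝔻` with `ω 0 = 0` and
`η_ν = η_μ ∘ ω` on the open unit disc `𝔻`. -/
def Subordinated (ν μ : ProbabilityMeasure Circle) : Prop :=
  ∃ ω : ℂ → ℂ, DifferentiableOn ℂ ω (Metric.ball 0 1) ∧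
    Set.MapsTo ω (Metric.ball 0 1) (Metric.ball 0 1) ∧ ω 0 = 0 ∧
    ∀ z ∈ Metric.ball (0 : ℂ) 1, eta ν z = eta μ (ω z)

/-- The probability measures on the circle with nonzero mean whose `η`-transform has no zero
in the punctured open unit disc. -/
def MTStar : Set (ProbabilityMeasure Circle) :=
  {μ | mean μ ≠ 0 ∧ ∀ z ∈ Metric.ball (0 : ℂ) 1, z ≠ 0 → eta μ z ≠ 0}

theorem IsLocalInverse.unique {f χ₁ χ₂ : ℂ → ℂ} (h₁ : IsLocalInverse f χ₁)
    (h₂ : IsLocalInverse f χ₂) : χ₁ =ᶠ[𝓝 0] χ₂ := by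
  obtain ⟨-, -, -, l₁⟩ := h₁
  obtain ⟨a₂, z₂, r₂, -⟩ := h₂
  have ht : Tendsto χ₂ (𝓝 0) (𝓝 0) := by
    have := a₂.continuousAt.tendsto
    rwa [z₂] at this
  filter_upwards [ht.eventually l₁, r₂] with z hz hz'
  rw [hz'] at hz
  exact hz

theorem hasDerivAt_psi (μ : ProbabilityMeasure Circle) {z : ℂ} (hz : ‖z‖ < 1) :
    HasDerivAt (psi μ)
      (∫ t : Circle, (t : ℂ) / (1 - (t : ℂ) * z) ^ 2 ∂(μ : Measure Circle)) z := by
  obtain ⟨r, hzr, hr1⟩ := exists_between hz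
  have hs : Metric.ball (0 : ℂ) r ∈ 𝓝 z := Metric.isOpen_ball.mem_nhds (by simpa using hzr)
  have key : ∀ (t : Circle) (x : ℂ), ‖x‖ < r → 1 - r ≤ ‖1 - (t : ℂ) * x‖ := by
    intro t x hx
    have h1 : ‖(1 : ℂ)‖ - ‖(t : ℂ) * x‖ ≤ ‖1 - (t : ℂ) * x‖ := norm_sub_norm_le _ _
    rw [norm_mul, Circle.norm_coe, norm_one, one_mul] at h1
    linarith
  have ne : ∀ (t : Circle) (x : ℂ), ‖x‖ < r → 1 - (t : ℂ) * x ≠ 0 := by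
    intro t x hx h0
    have := key t x hx
    rw [h0, norm_zero] at this
    linarith
  have hc : ∀ x : ℂ, ‖x‖ < r →
      Continuous fun t : Circle => (t : ℂ) * x / (1 - (t : ℂ) * x) := by
    intro x hx
    exact Continuous.div (by fun_prop) (by fun_prop) (fun t => ne t x hx)
  refine (hasDerivAt_integral_of_dominated_loc_of_deriv_le (μ := (μ : Measure Circle))
    (bound := fun _ : Circle => 1 / (1 - r) ^ 2)
    (F := fun (x : ℂ) (t : Circle) => (t : ℂ) * x / (1 - (t : ℂ) * x))
    (F' := fun (x : ℂ) (t : Circle) => (t : ℂ) / (1 - (t : ℂ) * x) ^ 2) hs ?_ ?_ ?_ ?_ ?_ ?_).2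
  · filter_upwards [hs] with x hx
    exact (hc x (by simpa using hx)).aestronglyMeasurable
  · exact (hc z hzr).integrable_of_hasCompactSupport (HasCompactSupport.of_compactSpace _)
  · refine Continuous.aestronglyMeasurable ?_
    exact Continuous.div (by fun_prop) (by fun_prop) (fun t => pow_ne_zero 2 (ne t z hzr))
  · refine Eventually.of_forall fun t x hx => ?_
    have hx' : ‖x‖ < r := by simpa using hx
    rw [norm_div, norm_pow, Circle.norm_coe]
    have := key t x hx'
    have h1 : 0 < 1 - r := by linarith
    gcongr
  · exact integrable_const _
  · refine Eventually.of_forall fun t x hx => ?_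
    have hx' : ‖x‖ < r := by simpa using hx
    have h1 : HasDerivAt (fun x : ℂ => (t : ℂ) * x) (t : ℂ) x := by
      simpa using (hasDerivAt_id x).const_mul (t : ℂ)
    have h2 : HasDerivAt (fun x : ℂ => 1 - (t : ℂ) * x) (-(t : ℂ)) x := by
      simpa using h1.const_sub 1
    refine (h1.div h2 (ne t x hx')).congr_deriv ?_
    congr 1
    ring

theorem psi_zero (μ : ProbabilityMeasure Circle) : psi μ 0 = 0 := by
  simp [psi]

theorem analyticAt_eta (μ : ProbabilityMeasure Circle) : AnalyticAt ℂ (eta μ) 0 := by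
  have h : AnalyticAt ℂ (psi μ) 0 := by
    refine DifferentiableOn.analyticAt (s := Metric.ball 0 1) ?_
      (Metric.ball_mem_nhds 0 one_pos)
    intro z hz
    exact (hasDerivAt_psi μ (by simpa using hz)).differentiableAt.differentiableWithinAt
  exact h.div (analyticAt_const.add h) (by simp [psi_zero])

theorem hasDerivAt_eta_zero (μ : ProbabilityMeasure Circle) :
    HasDerivAt (eta μ) (mean μ) 0 := by
  have h := hasDerivAt_psi μ (z := 0) (by simp)
  refine (h.div (h.const_add 1) (by simp [psi_zero])).congr_deriv ?_
  simp [psi_zero, mean]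

/-- For `μ` of nonzero mean, `η_μ` has an analytic inverse near the origin. -/
theorem exists_isLocalInverse_eta (μ : ProbabilityMeasure Circle) (h : mean μ ≠ 0) :
    ∃ χ, IsLocalInverse (eta μ) χ := by
  have ha := analyticAt_eta μ
  have h0 : eta μ 0 = 0 := by simp [eta, psi_zero]
  have hd : deriv (eta μ) 0 ≠ 0 := by rwa [(hasDerivAt_eta_zero μ).deriv]
  have h1 := ha.analyticAt_localInverse hd
  have h2 := (ha.hasStrictDerivAt.hasStrictFDerivAt_equiv hd).eventually_right_inverse
  have h3 := (ha.hasStrictDerivAt.hasStrictFDerivAt_equiv hd).eventually_left_inverse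
  have h4 := (ha.hasStrictDerivAt.hasStrictFDerivAt_equiv hd).localInverse_apply_image
  rw [h0] at h1 h2 h4
  exact ⟨_, h1, h4, h2, h3⟩

theorem isLocalInverse_etaInv (μ : ProbabilityMeasure Circle) (h : mean μ ≠ 0) :
    IsLocalInverse (eta μ) (etaInv μ) := by
  have hex := exists_isLocalInverse_eta μ h
  rw [etaInv, dif_pos hex]
  exact hex.choose_spec

end CircleTransform

end

open MeasureTheory Filter Topology Metric Set
open scoped ComplexConjugate

namespace CircleTransform

/-! ### Self-maps of the disc which omit a value -/

/-! Suppose `η_μ(a) = 0` with `0 < |a| < 1`, and take `t = 1 + 1/n` with subordination function `ω`.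
Near the origin, `ω(z) = u Σ_μ(u)` and `z = u Σ_μ(u)^t` with `u = η_μ(ω(z))`. Eliminating the power
gives `z^n η_μ(ω(z)) = ω(z)^(n+1)` on the whole disc (`pow_mul_eta_eq`), so `ω(z) = a` would force
`a = 0`: every such `ω` omits `a`. By `exists_norm_deriv_le_of_omits`, `|ω'(0)| ≤ q` for some `q <
1` independent of `n`. But `|ω'(0)|^n |Σ_μ(0)| = 1` (`norm_deriv_pow_mul_norm_sigmaTransform`),
which is impossible for large `n`. -/

theorem norm_one_sub_conj_mul_sq (a w : ℂ) :
    ‖1 - conj a * w‖ ^ 2 = ‖w - a‖ ^ 2 + (1 - ‖a‖ ^ 2) * (1 - ‖w‖ ^ 2) := by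
  simp only [← Complex.normSq_eq_norm_sq, Complex.normSq_apply, Complex.sub_re, Complex.sub_im,
    Complex.mul_re, Complex.mul_im, Complex.conj_re, Complex.conj_im, Complex.one_re,
    Complex.one_im]
  ring

theorem one_sub_conj_mul_ne_zero {a w : ℂ} (ha : ‖a‖ < 1) (hw : ‖w‖ ≤ 1) :
    1 - conj a * w ≠ 0 := by
  intro h
  have h1 : ‖conj a * w‖ = 1 := by rw [← sub_eq_zero.1 h, norm_one]
  rw [norm_mul, RCLike.norm_conj] at h1
  nlinarith [norm_nonneg a, norm_nonneg w]

/-- A form of the Schwarz-Pick estimate. -/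
theorem one_sub_norm_mul_norm_sub_le {g : ℂ → ℂ} (hd : DifferentiableOn ℂ g (ball 0 1))
    (hg : ∀ z ∈ ball (0 : ℂ) 1, ‖g z‖ ≤ 1) (h0 : ‖g 0‖ < 1) {z : ℂ} (hz : ‖z‖ < 1) :
    (1 - ‖z‖) * ‖g z - g 0‖ ≤ 1 - ‖g 0‖ ^ 2 := by
  have hz' : z ∈ ball (0 : ℂ) 1 := by simpa using hz
  have ne : ∀ w ∈ ball (0 : ℂ) 1, 1 - conj (g 0) * g w ≠ 0 := fun w hw =>
    one_sub_conj_mul_ne_zero h0 (hg w hw)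
  -- Schwarz lemma for `g` followed by the disc automorphism sending `g 0` to `0`.
  have hs : ‖(g z - g 0) / (1 - conj (g 0) * g z)‖ ≤ ‖z‖ := by
    refine Complex.norm_le_norm_of_mapsTo_ball (R := 1)
      (f := fun w => (g w - g 0) / (1 - conj (g 0) * g w))
      ((hd.sub_const _).div ((hd.const_mul _).const_sub _) ne) ?_ (by simp) hz
    intro w hw
    have hpos := norm_pos_iff.2 (ne w hw)
    rw [mem_closedBall_zero_iff, norm_div, div_le_one hpos]
    refine le_of_sq_le_sq ?_ hpos.le
    rw [norm_one_sub_conj_mul_sq]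
    have := hg w hw
    have h1 : 0 ≤ 1 - ‖g 0‖ ^ 2 := by nlinarith [norm_nonneg (g 0)]
    have h2 : 0 ≤ 1 - ‖g w‖ ^ 2 := by nlinarith [norm_nonneg (g w)]
    nlinarith [mul_nonneg h1 h2]
  rw [norm_div, div_le_iff₀ (norm_pos_iff.2 (ne z hz'))] at hs
  have h3 : ‖1 - conj (g 0) * g z‖ ≤ (1 - ‖g 0‖ ^ 2) + ‖g z - g 0‖ := by
    have e : 1 - conj (g 0) * g z = ((1 - ‖g 0‖ ^ 2 : ℝ) : ℂ) - conj (g 0) * (g z - g 0) := by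
      push_cast
      rw [← Complex.conj_mul']
      ring
    rw [e]
    refine (norm_sub_le _ _).trans ?_
    rw [Complex.norm_real, Real.norm_of_nonneg (by nlinarith [norm_nonneg (g 0)]), norm_mul,
      RCLike.norm_conj]
    nlinarith [norm_nonneg (g z - g 0)]
  have h4 : 0 ≤ 1 - ‖g 0‖ ^ 2 := by nlinarith [norm_nonneg (g 0)]
  nlinarith [norm_nonneg z]

/-- The pseudo-hyperbolic disc with centre `a` and radius `‖a‖` has `0` on its boundary; its point
farthest from `0` has modulus `2‖a‖ / (1 + ‖a‖²)`. -/
theorem norm_mul_norm_one_sub_conj_mul_lt {a w : ℂ} (ha : ‖a‖ < 1)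
    (hw : 2 * ‖a‖ / (1 + ‖a‖ ^ 2) < ‖w‖) : ‖a‖ * ‖1 - conj a * w‖ < ‖w - a‖ := by
  have hw0 : 0 < ‖w‖ := lt_of_le_of_lt (by positivity) hw
  rw [div_lt_iff₀ (by positivity)] at hw
  refine lt_of_pow_lt_pow_left₀ 2 (norm_nonneg _) ?_
  rw [mul_pow, norm_one_sub_conj_mul_sq]
  have h1 : ‖w - a‖ ^ 2 = ‖w‖ ^ 2 - 2 * (conj a * w).re + ‖a‖ ^ 2 := by
    simp only [← Complex.normSq_eq_norm_sq, Complex.normSq_apply, Complex.sub_re, Complex.sub_im,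
      Complex.mul_re, Complex.conj_re, Complex.conj_im]
    ring
  have h2 : (conj a * w).re ≤ ‖a‖ * ‖w‖ := by
    simpa [norm_mul] using Complex.re_le_norm (conj a * w)
  have h3 : 0 < 1 - ‖a‖ ^ 2 := by nlinarith [norm_nonneg a]
  rw [h1]
  nlinarith [mul_pos h3 (mul_pos hw0 (sub_pos.2 hw)), mul_le_mul_of_nonneg_left h2 h3.le]

/-- An analytic self-map of the disc which fixes the origin and omits `a` has derivative at the
origin bounded away from `1`, uniformly. -/
theorem exists_norm_deriv_le_of_omits {a : ℂ} (ha : ‖a‖ < 1) (ha0 : a ≠ 0) :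
    ∃ q < 1, ∀ ω : ℂ → ℂ, DifferentiableOn ℂ ω (ball 0 1) →
      MapsTo ω (ball 0 1) (ball 0 1) → ω 0 = 0 → (∀ z ∈ ball (0 : ℂ) 1, ω z ≠ a) →
      ‖deriv ω 0‖ ≤ q := by
  have hs0 : 0 < ‖a‖ := norm_pos_iff.2 ha0
  obtain ⟨ρ, hρ⟩ : ∃ ρ, ρ = 2 * ‖a‖ / (1 + ‖a‖ ^ 2) := ⟨_, rfl⟩
  have hρ1 : ρ < 1 := by
    rw [hρ, div_lt_one (by positivity)]
    nlinarith [sq_pos_of_pos (sub_pos.2 ha)]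
  have hρ0 : 0 < ρ := by rw [hρ]; positivity
  obtain ⟨r, hρr, hr1⟩ := exists_between hρ1
  have hr0 : 0 < r := hρ0.trans hρr
  -- With `x = ‖ω'(0)‖`, this is the Schwarz-Pick lower bound for `‖ω z‖` on `‖z‖ = r`. It exceeds
  -- `ρ` for `x` close to `1`, and how close depends only on `a` and `r`.
  have hlim : Tendsto (fun x : ℝ => r * (x - (1 - x ^ 2) / (1 - r))) (𝓝[<] 1) (𝓝 r) := by
    have hc : Continuous fun x : ℝ => r * (x - (1 - x ^ 2) / (1 - r)) := by fun_prop
    have := hc.tendsto 1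
    simp only [one_pow, sub_self, zero_div, sub_zero, mul_one] at this
    exact this.mono_left nhdsWithin_le_nhds
  obtain ⟨q, hq1, hq⟩ := (mem_nhdsLT_iff_exists_Ioo_subset (a := (1 : ℝ))).1
    (hlim.eventually (lt_mem_nhds hρr))
  refine ⟨q, hq1, fun ω hd hm h0 homit => ?_⟩
  by_contra! hlt
  have hm' : MapsTo ω (ball 0 1) (closedBall (ω 0) 1) := by
    rw [h0]
    exact hm.mono_right ball_subset_closedBall
  obtain ⟨g, hg⟩ : ∃ g, g = dslope ω 0 := ⟨_, rfl⟩
  have hωg : ∀ z, ω z = z * g z := by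
    intro z
    have := sub_smul_dslope ω 0 z
    rw [sub_zero, h0, sub_zero, ← hg, smul_eq_mul] at this
    exact this.symm
  have hgd : DifferentiableOn ℂ g (ball 0 1) := by
    rw [hg]
    exact (Complex.differentiableOn_dslope (ball_mem_nhds 0 one_pos)).2 hd
  have hg1 : ∀ z ∈ ball (0 : ℂ) 1, ‖g z‖ ≤ 1 := by
    intro z hz
    rw [hg]
    simpa using Complex.norm_dslope_le_div_of_mapsTo_ball hd hm' hz
  have hg0 : g 0 = deriv ω 0 := by rw [hg, dslope_same]
  have h0mem : (0 : ℂ) ∈ ball (0 : ℂ) 1 := mem_ball_self one_pos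
  -- If `‖ω'(0)‖ = 1`, then `ω` is a rotation and takes the value `a`.
  rcases (hg1 0 h0mem).eq_or_lt with heq | hlt1
  · have hrot := Complex.affine_of_mapsTo_ball_of_norm_dslope_eq_div hd hm' h0mem
      (by rw [← hg, heq, div_one])
    have hne : g 0 ≠ 0 := norm_pos_iff.1 (by rw [heq]; exact one_pos)
    have hmem : a / g 0 ∈ ball (0 : ℂ) 1 := by
      rw [mem_ball_zero_iff, norm_div, heq, div_one]
      exact ha
    refine homit _ hmem ?_
    rw [hrot hmem]
    simp only [h0, ← hg, sub_zero, zero_add, smul_eq_mul]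
    exact div_mul_cancel₀ a hne
  · have hsph : ∀ z : ℂ, ‖z‖ = r → ρ < ‖ω z‖ := by
      intro z hz
      have h1 := one_sub_norm_mul_norm_sub_le hgd hg1 hlt1 (z := z) (by rwa [hz])
      rw [hz, ← le_div_iff₀' (sub_pos.2 hr1)] at h1
      have h2 := norm_sub_norm_le (g 0) (g z)
      rw [norm_sub_rev] at h2
      have h3 : ρ < r * (‖g 0‖ - (1 - ‖g 0‖ ^ 2) / (1 - r)) := hq ⟨by rwa [hg0], hlt1⟩
      rw [hωg, norm_mul, hz]
      refine h3.trans_le (mul_le_mul_of_nonneg_left ?_ hr0.le)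
      linarith
    have hsub : closedBall (0 : ℂ) r ⊆ ball 0 1 := closedBall_subset_ball hr1
    -- Analytic because `ω` omits `a`. Its modulus is `1 / ‖a‖` at the origin but smaller on `‖z‖ =
    -- r`, where `‖ω z‖ > ρ`, against the maximum principle.
    have hdiff : DifferentiableOn ℂ (fun z => (1 - conj a * ω z) / (ω z - a)) (ball 0 1) :=
      ((hd.const_mul _).const_sub _).div (hd.sub_const _) fun z hz => sub_ne_zero.2 (homit z hz)
    obtain ⟨z, hz, hmax⟩ := Complex.exists_mem_frontier_isMaxOn_norm (U := ball (0 : ℂ) r)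
      isBounded_ball (nonempty_ball.2 hr0)
      (hdiff.mono (by rwa [closure_ball _ hr0.ne'])).diffContOnCl
    rw [frontier_ball _ hr0.ne', mem_sphere_zero_iff_norm] at hz
    have hle := hmax (subset_closure (mem_ball_self hr0))
    simp only [mem_ofPred_eq, Function.comp_apply, h0, mul_zero, sub_zero, zero_sub, norm_div,
      norm_one, norm_neg] at hle
    have hzm : z ∈ ball (0 : ℂ) 1 := hsub (by simp [hz])
    have hpos : 0 < ‖ω z - a‖ := norm_pos_iff.2 (sub_ne_zero.2 (homit z hzm))
    rw [div_le_div_iff₀ hs0 hpos, one_mul] at hle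
    have := norm_mul_norm_one_sub_conj_mul_lt ha (w := ω z) (by rw [← hρ]; exact hsph z hz)
    linarith

/-! ### The `η`-transform on the disc -/

/-- The map `w ↦ w / (1 - w)` sends the disc into `Re > -1/2`, and averaging gives `Re ψ_μ ≥ -1/2`.
-/
theorem one_add_psi_ne_zero (μ : ProbabilityMeasure Circle) {z : ℂ} (hz : ‖z‖ < 1) :
    1 + psi μ z ≠ 0 := by
  have hlt : ∀ t : Circle, ‖(t : ℂ) * z‖ < 1 := fun t => by
    rwa [norm_mul, Circle.norm_coe, one_mul]
  have ne : ∀ t : Circle, 1 - (t : ℂ) * z ≠ 0 := by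
    intro t h0
    have := hlt t
    rw [← sub_eq_zero.1 h0, norm_one] at this
    exact this.false
  have hc : Continuous fun t : Circle => (t : ℂ) * z / (1 - (t : ℂ) * z) :=
    Continuous.div (by fun_prop) (by fun_prop) ne
  have hint : Integrable (fun t : Circle => (t : ℂ) * z / (1 - (t : ℂ) * z))
      (μ : Measure Circle) :=
    hc.integrable_of_hasCompactSupport (HasCompactSupport.of_compactSpace _)
  have hre : -(1 / 2) ≤ (psi μ z).re := by
    rw [psi, ← RCLike.re_eq_complex_re, ← integral_re hint]
    have : ∫ _ : Circle, (-(1 / 2) : ℝ) ∂(μ : Measure Circle) = -(1 / 2) := by simp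
    rw [← this]
    refine integral_mono (integrable_const _) hint.re fun t => ?_
    have hpos := Complex.normSq_pos.2 (ne t)
    have hn : Complex.normSq ((t : ℂ) * z) < 1 := by
      rw [Complex.normSq_eq_norm_sq]
      have := hlt t
      nlinarith [norm_nonneg ((t : ℂ) * z)]
    generalize (t : ℂ) * z = w at hpos hn
    rw [RCLike.re_eq_complex_re, Complex.div_re, ← add_div, le_div_iff₀ hpos]
    simp only [Complex.normSq_apply, Complex.sub_re, Complex.sub_im, Complex.one_re,
      Complex.one_im] at hn ⊢
    nlinarith
  intro h
  have := congrArg Complex.re h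
  rw [Complex.add_re, Complex.one_re, Complex.zero_re] at this
  linarith

theorem differentiableOn_eta (μ : ProbabilityMeasure Circle) :
    DifferentiableOn ℂ (eta μ) (ball 0 1) := by
  have h : DifferentiableOn ℂ (psi μ) (ball 0 1) := fun z hz =>
    (hasDerivAt_psi μ (by simpa using hz)).differentiableAt.differentiableWithinAt
  exact h.div (h.const_add 1) fun z hz => one_add_psi_ne_zero μ (by simpa using hz)

theorem eta_zero (μ : ProbabilityMeasure Circle) : eta μ 0 = 0 := by
  simp [eta, psi_zero]

theorem mul_sigmaTransform {μ : ProbabilityMeasure Circle} (h : mean μ ≠ 0) (z : ℂ) :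
    z * sigmaTransform μ z = etaInv μ z := by
  have := sub_smul_dslope (etaInv μ) 0 z
  rwa [(isLocalInverse_etaInv μ h).2.1, sub_zero, sub_zero, smul_eq_mul] at this

/-! ### Powers of the `Σ`-transform and subordination -/

section Power

variable {μ ν : ProbabilityMeasure Circle} {ω : ℂ → ℂ} {n : ℕ}

/-- The subordination function of the `Σ`-power of exponent `1 + 1 / n`, near the origin. -/
theorem exists_eventually_eq_of_isPower (hμ : mean μ ≠ 0) (hν : mean ν ≠ 0) {t : ℝ}
    (hP : IsPower (sigmaTransform ν) (sigmaTransform μ) t)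
    (hd : DifferentiableOn ℂ ω (ball 0 1)) (h0 : ω 0 = 0)
    (hsub : ∀ z ∈ ball (0 : ℂ) 1, eta ν z = eta μ (ω z)) :
    ∃ L : ℂ → ℂ, AnalyticAt ℂ L 0 ∧ sigmaTransform μ 0 = Complex.exp (L 0) ∧
      ∀ᶠ z in 𝓝 0, ω z = eta μ (ω z) * Complex.exp (L (eta μ (ω z))) ∧
        z = eta μ (ω z) * Complex.exp ((t : ℂ) * L (eta μ (ω z))) := by
  obtain ⟨L, hL, hLμ, hLν⟩ := hP
  refine ⟨L, hL, hLμ.self_of_nhds, ?_⟩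
  have hω : Tendsto ω (𝓝 0) (𝓝 0) := by
    have := (hd.differentiableAt (ball_mem_nhds 0 one_pos)).continuousAt.tendsto
    rwa [h0] at this
  have hη : Tendsto (eta μ) (𝓝 0) (𝓝 0) := by
    have := (analyticAt_eta μ).continuousAt.tendsto
    rwa [eta_zero] at this
  have hu := hη.comp hω
  filter_upwards [hω.eventually (isLocalInverse_etaInv μ hμ).2.2.2,
    (isLocalInverse_etaInv ν hν).2.2.2, hu.eventually hLμ, hu.eventually hLν,
    ball_mem_nhds (0 : ℂ) one_pos] with z h1 h2 h3 h4 hz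
  simp only [Function.comp_apply] at h3 h4
  rw [hsub z hz] at h2
  rw [← h3, ← h4, mul_sigmaTransform hμ, mul_sigmaTransform hν]
  exact ⟨h1.symm, h2.symm⟩

/-- Since `n (1 + 1/n) = n + 1`, both sides equal `u^(n+1) exp((n+1) L(u))` near the origin, where
`u = η_μ(ω(z))`; the identity theorem does the rest. -/
theorem pow_mul_eta_eq (hn : n ≠ 0) (hμ : mean μ ≠ 0) (hν : mean ν ≠ 0)
    (hP : IsPower (sigmaTransform ν) (sigmaTransform μ) (1 + 1 / n))
    (hd : DifferentiableOn ℂ ω (ball 0 1)) (hm : MapsTo ω (ball 0 1) (ball 0 1)) (h0 : ω 0 = 0)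
    (hsub : ∀ z ∈ ball (0 : ℂ) 1, eta ν z = eta μ (ω z)) :
    ∀ z ∈ ball (0 : ℂ) 1, z ^ n * eta μ (ω z) = ω z ^ (n + 1) := by
  obtain ⟨L, -, -, hev⟩ := exists_eventually_eq_of_isPower hμ hν hP hd h0 hsub
  have hn' : (n : ℂ) ≠ 0 := Nat.cast_ne_zero.2 hn
  have h1 : AnalyticOnNhd ℂ (fun z => z ^ n * eta μ (ω z)) (ball 0 1) :=
    ((differentiableOn_id.pow n).mul ((differentiableOn_eta μ).comp hd hm)).analyticOnNhd
      isOpen_ball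
  have h2 : AnalyticOnNhd ℂ (fun z => ω z ^ (n + 1)) (ball 0 1) :=
    (hd.pow (n + 1)).analyticOnNhd isOpen_ball
  refine h1.eqOn_of_preconnected_of_eventuallyEq h2 (convex_ball _ _).isPreconnected
    (mem_ball_self one_pos) ?_
  filter_upwards [hev] with z hz
  obtain ⟨hw, hz⟩ := hz
  generalize eta μ (ω z) = u at hw hz
  rw [hw, hz, mul_pow, mul_pow, ← Complex.exp_nat_mul, ← Complex.exp_nat_mul]
  have : (n : ℂ) * (((1 + 1 / n : ℝ) : ℂ) * L u) = ((n + 1 : ℕ) : ℂ) * L u := by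
    push_cast
    field_simp
  rw [this]
  ring

/-- Dividing the two local formulas gives `ω(z) = z exp(-L(u) / n)`, hence `ω'(0) = exp(-L(0) / n)`.
The branch `L` may vary with `n`, but the `n`-th power `exp(-L(0)) = 1 / Σ_μ(0)` does not. -/
theorem norm_deriv_pow_mul_norm_sigmaTransform (hn : n ≠ 0) (hμ : mean μ ≠ 0) (hν : mean ν ≠ 0)
    (hP : IsPower (sigmaTransform ν) (sigmaTransform μ) (1 + 1 / n))
    (hd : DifferentiableOn ℂ ω (ball 0 1)) (h0 : ω 0 = 0)
    (hsub : ∀ z ∈ ball (0 : ℂ) 1, eta ν z = eta μ (ω z)) :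
    ‖deriv ω 0‖ ^ n * ‖sigmaTransform μ 0‖ = 1 := by
  obtain ⟨L, hL, hσ, hev⟩ := exists_eventually_eq_of_isPower hμ hν hP hd h0 hsub
  have hn' : (n : ℂ) ≠ 0 := Nat.cast_ne_zero.2 hn
  have hωd := (hd.differentiableAt (ball_mem_nhds 0 one_pos))
  obtain ⟨k, hk⟩ : ∃ k : ℂ → ℂ, k = fun z => Complex.exp (-(L (eta μ (ω z)) / n)) := ⟨_, rfl⟩
  have hkd : DifferentiableAt ℂ k 0 := by
    have h1 : DifferentiableAt ℂ (eta μ) (ω 0) := by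
      rw [h0]; exact (analyticAt_eta μ).differentiableAt
    have h2 : DifferentiableAt ℂ L (eta μ (ω 0)) := by
      rw [h0, eta_zero]; exact hL.differentiableAt
    rw [hk]
    have h3 : DifferentiableAt ℂ (fun z => L (eta μ (ω z))) 0 :=
      h2.comp (0 : ℂ) (h1.comp (0 : ℂ) hωd)
    exact (h3.div_const _).neg.cexp
  have heq : ω =ᶠ[𝓝 0] fun z => z * k z := by
    filter_upwards [hev] with z hz
    obtain ⟨hw, hz⟩ := hz
    rw [hk]
    simp only
    generalize eta μ (ω z) = u at hw hz
    rw [hw, hz, mul_assoc, ← Complex.exp_add]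
    congr 2
    push_cast
    field_simp
    ring
  have hder : deriv ω 0 = k 0 := by
    rw [heq.deriv_eq]
    have := ((hasDerivAt_id (0 : ℂ)).mul hkd.hasDerivAt).deriv
    simpa using! this
  rw [hder, hσ, ← norm_pow, ← norm_mul, hk]
  simp only [h0, eta_zero]
  rw [← Complex.exp_nat_mul, ← Complex.exp_add]
  have : (n : ℂ) * -(L 0 / n) + L 0 = 0 := by
    field_simp
    ring
  rw [this, Complex.exp_zero, norm_one]

end Power

end CircleTransform

open CircleTransform in
theorem mainTheorem5 (μ : MeasureTheory.ProbabilityMeasure Circle)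
    (hμ : CircleTransform.mean μ ≠ 0)
    (h : ∀ t : ℝ, 1 < t → ∃ μt : MeasureTheory.ProbabilityMeasure Circle,
      CircleTransform.mean μt ≠ 0 ∧
      CircleTransform.IsPower (CircleTransform.sigmaTransform μt)
        (CircleTransform.sigmaTransform μ) t ∧
      CircleTransform.Subordinated μt μ) :
    μ ∈ CircleTransform.MTStar := by
  refine ⟨hμ, fun a ha ha0 hη => ?_⟩
  have ha1 : ‖a‖ < 1 := by simpa using ha
  obtain ⟨q, hq1, hq⟩ := exists_norm_deriv_le_of_omits ha1 ha0
  -- Nothing makes `q` nonnegative; `max q 0` is a base in `[0, 1)`, so its powers tend to `0`.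
  have hbound : ∀ n : ℕ, n ≠ 0 → 1 ≤ max q 0 ^ n * ‖sigmaTransform μ 0‖ := by
    intro n hn
    have hn' : (0 : ℝ) < n := Nat.cast_pos.2 (Nat.pos_of_ne_zero hn)
    obtain ⟨ν, hν, hP, ω, hd, hm, h0, hsub⟩ := h (1 + 1 / n) (by simpa using hn')
    rw [← norm_deriv_pow_mul_norm_sigmaTransform hn hμ hν hP hd h0 hsub]
    gcongr
    refine (hq ω hd hm h0 fun z hz hza => ?_).trans (le_max_left _ _)
    have := pow_mul_eta_eq hn hμ hν hP hd hm h0 hsub z hz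
    rw [hza, hη, mul_zero] at this
    exact ha0 (pow_eq_zero_iff (Nat.succ_ne_zero n) |>.1 this.symm)
  have hlim := (tendsto_pow_atTop_nhds_zero_of_lt_one (le_max_right q 0)
    (max_lt hq1 one_pos)).mul_const ‖sigmaTransform μ 0‖
  rw [zero_mul] at hlim
  have := ge_of_tendsto hlim ((eventually_ne_atTop 0).mono hbound)
  linarith
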